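/- For a subset $E\subseteq\mathbb{Z}$ let $\mathrm{Int}(E,\mathbb{Z})=\{f\in\mathbb{Q}[x] : f(E)\subseteq\mathbb{Z}\}$, and for $n\ge 0$ let $I_n(E)\subseteq\mathbb{Q}$ be the set consisting of $0$ and the leading coefficients of the elements of $\mathrm{Int}(E,\mathbb{Z})$ of degree at most $n$; when $E$ is infinite this is a fractional ideal of $\mathbb{Z}$. For a prime $p$ let $\alpha_{E,p}(n)=-\nu_p(I_n(E))$, where $\nu_p(I)$ denotes the minimum of the $p$-adic valuations of the nonzero elements of $I$. The valuative capacity of $E$ with respect to $p$ is $L_{E,p}=\lim_{n\to\infty}\alpha_{E,p}(n)/n$. Proposition. Let $d=2^{\alpha}\beta$ with $\alpha\ge 1$, $\beta\ge 1$ odd and $d>2$, and let $D=\{x^d : x\in\mathbb{Z}\}$ and $D+D=\{x^d+y^d : x,y\in\mathbb{Z}\}$. Then every $I_n(D+D)$ is a fractional ideal of $\mathbb{Z}$, the limit $L_{D+D}=L_{D+D,2}$ exists, and it is the unique positive root of $$(2\alpha+6)L^2+(2\alpha d-2\alpha+6d-7)L+(\alpha+3-\alpha^2 d-6\alpha d-9d)=0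 .$$ -/

import Mathlib

open scoped Pointwise
open Filter Topology Polynomial

/-- The ring `Int(E, ℤ)` of polynomials over `ℚ` taking integer values on `E ⊆ ℤ`. -/
def intValuedPoly (E : Set ℤ) : Subring ℚ[X] where
  carrier := {f | ∀ x ∈ E, ∃ m : ℤ, f.eval (x : ℚ) = (m : ℚ)}
  zero_mem' := fun x _ => ⟨0, by simp⟩
  one_mem' := fun x _ => ⟨1, by simp⟩
  add_mem' := by
    intro f g hf hg x hx
    obtain ⟨a, ha⟩ := hf x hx
    obtain ⟨b, hb⟩ := hg x hx
    exact ⟨a + b, by simp [ha, hb]⟩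
  mul_mem' := by
    intro f g hf hg x hx
    obtain ⟨a, ha⟩ := hf x hx
    obtain ⟨b, hb⟩ := hg x hx
    exact ⟨a * b, by simp [ha, hb]⟩
  neg_mem' := by
    intro f hf x hx
    obtain ⟨a, ha⟩ := hf x hx
    exact ⟨-a, by simp [ha]⟩

theorem X_mem_intValuedPoly (E : Set ℤ) : (X : ℚ[X]) ∈ intValuedPoly E :=
  fun x _ => ⟨x, by simp⟩

/-- The `n`-th characteristic ideal of `E`: `0` and the leading coefficients of the elements of
`Int(E, ℤ)` of degree at most `n` (the value `0` is the leading coefficient of the zero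
polynomial), as a `ℤ`-submodule of `ℚ`. -/
def charIdeal (E : Set ℤ) (n : ℕ) : Submodule ℤ ℚ where
  carrier := {c | ∃ f ∈ intValuedPoly E, f.natDegree ≤ n ∧ f.leadingCoeff = c}
  zero_mem' := ⟨0, zero_mem _, by simp, by simp⟩
  add_mem' := by
    rintro a b ⟨f, hf, hfn, rfl⟩ ⟨g, hg, hgn, rfl⟩
    by_cases h0 : f.leadingCoeff + g.leadingCoeff = 0
    · exact ⟨0, zero_mem _, by simp, by simp [h0]⟩
    have key : ∀ p : ℚ[X], p.natDegree ≤ n →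
        (p * X ^ (n - p.natDegree)).natDegree ≤ n ∧
        (p * X ^ (n - p.natDegree)).coeff n = p.leadingCoeff := by
      intro p hp
      refine ⟨?_, ?_⟩
      · refine natDegree_mul_le.trans ?_
        rw [natDegree_X_pow]
        omega
      · have h := coeff_mul_X_pow p (n - p.natDegree) p.natDegree
        rwa [Nat.add_sub_cancel' hp] at h
    obtain ⟨hf1, hf2⟩ := key f hfn
    obtain ⟨hg1, hg2⟩ := key g hgn
    have hX := X_mem_intValuedPoly E
    have hle := natDegree_add_le_of_degree_le hf1 hg1
    have hco : (f * X ^ (n - f.natDegree) + g * X ^ (n - g.natDegree)).coeff n =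
        f.leadingCoeff + g.leadingCoeff := by rw [coeff_add, hf2, hg2]
    have hdeg : (f * X ^ (n - f.natDegree) + g * X ^ (n - g.natDegree)).natDegree = n :=
      le_antisymm hle (le_natDegree_of_ne_zero (by rw [hco]; exact h0))
    refine ⟨_, add_mem (mul_mem hf (pow_mem hX _)) (mul_mem hg (pow_mem hX _)), hle, ?_⟩
    rw [leadingCoeff, hdeg, hco]
  smul_mem' := by
    rintro k c ⟨f, hf, hfn, rfl⟩
    refine ⟨((k : ℤ) : ℚ[X]) * f, mul_mem (intCast_mem _ k) hf, ?_, ?_⟩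
    · refine natDegree_mul_le.trans ?_
      simpa using hfn
    · rw [leadingCoeff_mul, zsmul_eq_mul, ← map_intCast (C : ℚ →+* ℚ[X]), leadingCoeff_C]

/-- The `p`-adic valuation of a fractional ideal of `ℤ` in `ℚ`: the least `p`-adic valuation
of its nonzero elements. -/
noncomputable def idealVal (p : ℕ) (I : Submodule ℤ ℚ) : ℤ :=
  sInf {v : ℤ | ∃ c ∈ I, c ≠ 0 ∧ padicValRat p c = v}

/-- The characteristic sequence `α_{E,p}(n)` of `E` with respect to `p`. -/
noncomputable def charSeq (E : Set ℤ) (p n : ℕ) : ℤ :=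
  -idealVal p (charIdeal E n)

/-- `L` is the valuative capacity of `E` with respect to `p`: every characteristic ideal is
a fractional ideal (so that the characteristic sequence is meaningful), and
`α_{E,p}(n) / n → L`. -/
def HasValuativeCapacity (E : Set ℤ) (p : ℕ) (L : ℝ) : Prop :=
  (∀ n, IsFractional (nonZeroDivisors ℤ) (charIdeal E n)) ∧
    Tendsto (fun n : ℕ => (charSeq E p n : ℝ) / (n : ℝ)) atTop (𝓝 L)

/-- The set `D` of `d`-th powers of integers. -/
def dthPowers (d : ℕ) : Set ℤ := Set.range fun x : ℤ => x ^ d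

/-! The 2-adic closure `S` of `D + D` is self-similar. Odd `d`-th powers are 2-adically dense in `1
+ 2^(α+2)ℤ`, and even ones are `2^d` times `d`-th powers, so sorting sums by parity gives `S = (1 +
2^(α+2)ℤ) ∪ 2((1 + 2^(α+1)ℤ) ∪ 2^(d-1) S)`. Capacity grows by `k` under `x ↦ c + 2^k x`, combines as
`l m / (l + m)` over pieces in different classes mod 2, and is `1` for `ℤ`. Hence `L` is a fixed
point of `powerSumCapacity`, which is the stated quadratic.

To obtain the limit as well, bounds from below (`CapacityGE`, monic polynomials) and above
(`CapacityLE`, interpolation nodes) are improved separately through the self-similarity until they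
meet at `L`; `hasValuativeCapacity_of_capacityGE_of_capacityLE` then squeezes `charSeq`. -/

/-- A lower bound for the valuative capacity: up to an error `o(n)`, some monic integer polynomial
of degree `n` takes values of valuation at least `l * n` on `E`. -/
def CapacityGE (p : ℕ) (E : Set ℤ) (l : ℝ) : Prop :=
  ∀ ε > 0, ∃ C : ℝ, ∀ n : ℕ, ∃ f : ℤ[X], f.Monic ∧ f.natDegree = n ∧
    ∃ e : ℕ, (l - ε) * n - C ≤ e ∧ ∀ x ∈ E, (p : ℤ) ^ e ∣ f.eval x

/-- An upper bound for the valuative capacity: up to an error `o(n)`, there are `n` points of `E`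
such that the product of the differences at each of them has valuation at most `u * n`. -/
def CapacityLE (p : ℕ) (E : Set ℤ) (u : ℝ) : Prop :=
  ∀ ε > 0, ∃ C : ℝ, ∀ n : ℕ, ∃ s : Finset ℤ, ↑s ⊆ E ∧ s.card = n ∧
    ∀ a ∈ s, ((∑ b ∈ s, padicValInt p (a - b) : ℕ) : ℝ) ≤ (u + ε) * n + C

/-- The integers that are `p`-adic limits of elements of `E`. -/
def padicClosure (p : ℕ) (E : Set ℤ) : Set ℤ :=
  {y | ∀ N : ℕ, ∃ x ∈ E, (p : ℤ) ^ N ∣ y - x}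

/-! ### Lower bounds -/

theorem CapacityGE.mono {p : ℕ} {E F : Set ℤ} {l m : ℝ} (h : CapacityGE p E l) (hFE : F ⊆ E)
    (hml : m ≤ l) : CapacityGE p F m := by
  intro ε hε
  obtain ⟨C, hC⟩ := h ε hε
  refine ⟨C, fun n => ?_⟩
  obtain ⟨f, hf, hn, e, he, hE⟩ := hC n
  refine ⟨f, hf, hn, e, le_trans ?_ he, fun x hx => hE x (hFE hx)⟩
  gcongr

theorem capacityGE_zero (p : ℕ) (E : Set ℤ) : CapacityGE p E 0 := by
  intro ε hε
  refine ⟨0, fun n => ⟨X ^ n, monic_X_pow n, natDegree_X_pow n, 0, ?_, by simp⟩⟩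
  have : 0 ≤ ε * n := by positivity
  push_cast
  linarith

theorem CapacityGE.of_forall_lt {p : ℕ} {E : Set ℤ} {L : ℝ}
    (h : ∀ m < L, ∃ l > m, CapacityGE p E l) : CapacityGE p E L := by
  intro ε hε
  obtain ⟨l, hl, hE⟩ := h (L - ε / 2) (by linarith)
  obtain ⟨C, hC⟩ := hE (ε / 2) (by linarith)
  refine ⟨C, fun n => ?_⟩
  obtain ⟨f, hf, hn, e, he, hE⟩ := hC n
  refine ⟨f, hf, hn, e, le_trans ?_ he, hE⟩
  gcongr ?_ * _ - _
  linarith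

/-- The supremum of the valid bounds up to `L` is itself valid, thanks to the `ε` in the definition;
below `L` it would be improved by `Φ`. No continuity of `Φ` is needed. -/
theorem CapacityGE.of_iterate {p : ℕ} {E : Set ℤ} {L : ℝ} (hL : 0 ≤ L) (Φ : ℝ → ℝ)
    (hΦ : ∀ l, 0 ≤ l → l < L → l < Φ l)
    (step : ∀ l, 0 ≤ l → l < L → CapacityGE p E l → CapacityGE p E (Φ l)) :
    CapacityGE p E L := by
  set T : Set ℝ := {l | 0 ≤ l ∧ l ≤ L ∧ CapacityGE p E l} with hT
  have h0 : (0 : ℝ) ∈ T := ⟨le_rfl, hL, capacityGE_zero p E⟩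
  have hb : BddAbove T := ⟨L, fun l hl => hl.2.1⟩
  have hsup : CapacityGE p E (sSup T) := by
    refine CapacityGE.of_forall_lt fun m hm => ?_
    obtain ⟨l, hl, hml⟩ := exists_lt_of_lt_csSup ⟨0, h0⟩ hm
    exact ⟨l, hml, hl.2.2⟩
  have hs0 : 0 ≤ sSup T := le_csSup hb h0
  rcases lt_or_ge (sSup T) L with hlt | hge
  · have h1 := hΦ _ hs0 hlt
    have h2 : min (Φ (sSup T)) L ∈ T :=
      ⟨le_min (hs0.trans h1.le) hL, min_le_right _ _,
        (step _ hs0 hlt hsup).mono subset_rfl (min_le_left _ _)⟩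
    exact absurd (le_csSup hb h2) (not_le.mpr (lt_min h1 hlt))
  · exact hsup.mono subset_rfl hge

/-- The polynomial `p^(kn) f((x - c)/p^k)` is integral and monic, and its values gain `p^(kn)`. -/
theorem CapacityGE.image_affine {p : ℕ} {E : Set ℤ} {l : ℝ} (h : CapacityGE p E l) (c : ℤ)
    (k : ℕ) : CapacityGE p ((fun x => c + (p : ℤ) ^ k * x) '' E) (k + l) := by
  intro ε hε
  obtain ⟨C, hC⟩ := h ε hε
  refine ⟨C, fun n => ?_⟩
  obtain ⟨f, hf, hn, e, he, hE⟩ := hC n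
  refine ⟨(scaleRoots f ((p : ℤ) ^ k)).comp (X - Polynomial.C c),
    ((monic_scaleRoots_iff _).2 hf).comp_X_sub_C c, ?_, k * n + e, ?_, ?_⟩
  · rw [natDegree_comp, natDegree_X_sub_C, mul_one, natDegree_scaleRoots, hn]
  · push_cast
    linarith
  · rintro _ ⟨x, hx, rfl⟩
    have := scaleRoots_eval₂_mul (p := f) (RingHom.id ℤ) x ((p : ℤ) ^ k)
    simp only [RingHom.id_apply, hn] at this
    simp only [eval_comp, eval_sub, eval_X, eval_C, add_sub_cancel_left]
    rw [eval₂_id, eval₂_id] at this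
    rw [this, pow_add, pow_mul]
    exact mul_dvd_mul_left _ (hE x hx)

/-- Multiply a polynomial of degree `a` for `E` by one of degree `n - a` for `F`; the two bounds
balance when `l a = m (n - a)`. -/
theorem CapacityGE.union {p : ℕ} {E F : Set ℤ} {l m : ℝ} (hE : CapacityGE p E l)
    (hF : CapacityGE p F m) (hl : 0 < l) (hm : 0 < m) :
    CapacityGE p (E ∪ F) (l * m / (l + m)) := by
  intro ε hε
  obtain ⟨C₁, h₁⟩ := hE ε hε
  obtain ⟨C₂, h₂⟩ := hF ε hε
  -- Rounding `t` down costs at most `l` on `E` and nothing on `F`.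
  refine ⟨max (C₁ + l) C₂, fun n => ?_⟩
  set t : ℝ := m / (l + m) * n with ht
  have ht0 : 0 ≤ t := by positivity
  have htn : t ≤ n := by
    refine mul_le_of_le_one_left (by positivity) ?_
    rw [div_le_one (by positivity)]
    linarith
  have hlt : l * m / (l + m) * n = l * t := by rw [ht]; ring
  have hmt : l * m / (l + m) * n = m * (n - t) := by rw [ht]; field_simp; ring
  set a := ⌊t⌋₊
  have ha : (a : ℝ) ≤ t := Nat.floor_le ht0
  have ha' : t < a + 1 := Nat.lt_floor_add_one t
  have han : a ≤ n := by exact_mod_cast ha.trans htn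
  obtain ⟨f, hf, hfn, e, he, hfE⟩ := h₁ a
  obtain ⟨g, hg, hgn, e', he', hgF⟩ := h₂ (n - a)
  rw [Nat.cast_sub han] at he'
  refine ⟨f * g, hf.mul hg, by rw [hf.natDegree_mul hg, hfn, hgn]; omega, min e e', ?_, ?_⟩
  · rw [Nat.cast_min]
    have e1 : ε * a ≤ ε * n := by gcongr
    have e2 : ε * (n - a) ≤ ε * n := by gcongr; simp
    have e3 : l * t ≤ l * (a + 1) := by gcongr
    have e4 : m * (n - t) ≤ m * (n - a) := by gcongr
    refine le_min ?_ ?_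
    · have := le_max_left (C₁ + l) C₂
      linarith
    · have := le_max_right (C₁ + l) C₂
      linarith
  · rintro x (hx | hx) <;> rw [eval_mul]
    · exact ((pow_dvd_pow _ (min_le_left _ _)).trans (hfE x hx)).mul_right _
    · exact ((pow_dvd_pow _ (min_le_right _ _)).trans (hgF x hx)).mul_left _

/-- Splitting `ℤ` by parity improves `l` to `(1 + l) / 2`, whose fixed point is `1`. -/
theorem capacityGE_two_univ : CapacityGE 2 Set.univ 1 := by
  refine CapacityGE.of_iterate zero_le_one (fun l => (1 + l) / 2) (fun l _ hl => by linarith)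
    fun l h0 _ hl => ?_
  have h1 := hl.image_affine 0 1
  have h2 := hl.image_affine 1 1
  refine (h1.union h2 ?_ ?_).mono ?_ ?_
  · push_cast; linarith
  · push_cast; linarith
  · intro x _
    rcases Int.even_or_odd' x with ⟨k, hk | hk⟩
    · exact Or.inl ⟨k, trivial, by simp [hk]⟩
    · exact Or.inr ⟨k, trivial, by simp [hk]; ring⟩
  · refine le_of_eq ?_
    push_cast
    have : 1 + l ≠ 0 := by linarith
    field_simp
    ring

/-! ### Upper bounds -/

theorem CapacityLE.mono {p : ℕ} {E F : Set ℤ} {u v : ℝ} (h : CapacityLE p E u) (hEF : E ⊆ F)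
    (huv : u ≤ v) : CapacityLE p F v := by
  intro ε hε
  obtain ⟨C, hC⟩ := h ε hε
  refine ⟨C, fun n => ?_⟩
  obtain ⟨s, hs, hn, hv⟩ := hC n
  refine ⟨s, hs.trans hEF, hn, fun a ha => (hv a ha).trans ?_⟩
  gcongr

theorem CapacityLE.of_forall_gt {p : ℕ} {E : Set ℤ} {L : ℝ}
    (h : ∀ m > L, ∃ u < m, CapacityLE p E u) : CapacityLE p E L := by
  intro ε hε
  obtain ⟨l, hl, hE⟩ := h (L + ε / 2) (by linarith)
  obtain ⟨C, hC⟩ := hE (ε / 2) (by linarith)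
  refine ⟨C, fun n => ?_⟩
  obtain ⟨s, hs, hn, hv⟩ := hC n
  refine ⟨s, hs, hn, fun a ha => (hv a ha).trans ?_⟩
  gcongr ?_ * _ + _
  linarith

theorem CapacityLE.of_iterate {p : ℕ} {E : Set ℤ} {L U : ℝ} (hLU : L ≤ U)
    (hU : CapacityLE p E U) (Φ : ℝ → ℝ) (hΦ : ∀ u, L < u → Φ u < u)
    (step : ∀ u, L < u → CapacityLE p E u → CapacityLE p E (Φ u)) :
    CapacityLE p E L := by
  set T : Set ℝ := {u | L ≤ u ∧ CapacityLE p E u} with hT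
  have hUT : U ∈ T := ⟨hLU, hU⟩
  have hb : BddBelow T := ⟨L, fun l hl => hl.1⟩
  have hinf : CapacityLE p E (sInf T) := by
    refine CapacityLE.of_forall_gt fun m hm => ?_
    obtain ⟨l, hl, hml⟩ := exists_lt_of_csInf_lt ⟨U, hUT⟩ hm
    exact ⟨l, hml, hl.2⟩
  rcases lt_or_ge L (sInf T) with hlt | hge
  · have h1 := hΦ _ hlt
    have h2 : max (Φ (sInf T)) L ∈ T :=
      ⟨le_max_right _ _, (step _ hlt hinf).mono subset_rfl (le_max_left _ _)⟩
    exact absurd (csInf_le hb h2) (not_le.mpr (max_lt h1 hlt))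
  · exact hinf.mono subset_rfl hge

/-- Only an inequality, because `padicValInt p 0 = 0`; the case `z = 0` is the diagonal term of the
sums in `CapacityLE`. -/
theorem padicValInt_pow_mul_le {p : ℕ} [Fact p.Prime] (k : ℕ) (z : ℤ) :
    padicValInt p ((p : ℤ) ^ k * z) ≤ k + padicValInt p z := by
  have hp : (p : ℤ) ≠ 0 := by exact_mod_cast (Fact.out : p.Prime).ne_zero
  rcases eq_or_ne z 0 with rfl | hz
  · simp
  · rw [padicValInt.mul (pow_ne_zero k hp) hz]
    refine le_of_eq ?_
    congr 1
    have : ((p : ℤ) ^ k).natAbs = p ^ k := by simp [Int.natAbs_pow]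
    rw [padicValInt, this, padicValNat.prime_pow]

theorem CapacityLE.image_affine {p : ℕ} [Fact p.Prime] {E : Set ℤ} {u : ℝ}
    (h : CapacityLE p E u) (c : ℤ) (k : ℕ) :
    CapacityLE p ((fun x => c + (p : ℤ) ^ k * x) '' E) (k + u) := by
  have hp : (p : ℤ) ^ k ≠ 0 := pow_ne_zero k (by exact_mod_cast (Fact.out : p.Prime).ne_zero)
  have hinj : Function.Injective fun x : ℤ => c + (p : ℤ) ^ k * x := fun x y hxy =>
    mul_left_cancel₀ hp (add_left_cancel hxy)
  intro ε hε
  obtain ⟨C, hC⟩ := h ε hε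
  refine ⟨C, fun n => ?_⟩
  obtain ⟨s, hs, hn, hv⟩ := hC n
  refine ⟨s.map ⟨_, hinj⟩, ?_, by rw [Finset.card_map, hn], ?_⟩
  · rw [Finset.coe_map]
    exact Set.image_mono hs
  · intro a' ha'
    obtain ⟨a, ha, rfl⟩ := Finset.mem_map.1 ha'
    rw [Finset.sum_map]
    have : ∑ b ∈ s, padicValInt p ((c + (p : ℤ) ^ k * a) - (c + (p : ℤ) ^ k * b)) ≤
        k * n + ∑ b ∈ s, padicValInt p (a - b) := by
      calc _ ≤ ∑ b ∈ s, (k + padicValInt p (a - b)) := Finset.sum_le_sum fun b _ => by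
            rw [add_sub_add_left_eq_sub, ← mul_sub]
            exact padicValInt_pow_mul_le k _
        _ = _ := by rw [Finset.sum_add_distrib, Finset.sum_const, hn, smul_eq_mul, mul_comm]
    have h2 := hv a ha
    have h3 : ((∑ b ∈ s, padicValInt p ((c + (p : ℤ) ^ k * a) - (c + (p : ℤ) ^ k * b)) : ℕ) : ℝ) ≤
        k * n + ((∑ b ∈ s, padicValInt p (a - b) : ℕ) : ℝ) := by exact_mod_cast this
    refine h3.trans ?_
    linarith

/-- Differences across the two sets are prime to `p` and contribute nothing, so the nodes are shared
out in the balancing proportion. -/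
theorem CapacityLE.union {p : ℕ} {E F : Set ℤ} {u v : ℝ} (hE : CapacityLE p E u)
    (hF : CapacityLE p F v) (hu : 0 < u) (hv : 0 < v)
    (hEF : ∀ x ∈ E, ∀ y ∈ F, ¬ (p : ℤ) ∣ x - y) :
    CapacityLE p (E ∪ F) (u * v / (u + v)) := by
  intro ε hε
  obtain ⟨C₁, h₁⟩ := hE ε hε
  obtain ⟨C₂, h₂⟩ := hF ε hε
  refine ⟨max C₁ (C₂ + v), fun n => ?_⟩
  set t : ℝ := v / (u + v) * n with ht
  have ht0 : 0 ≤ t := by positivity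
  have htn : t ≤ n := by
    refine mul_le_of_le_one_left (by positivity) ?_
    rw [div_le_one (by positivity)]
    linarith
  have hut : u * v / (u + v) * n = u * t := by rw [ht]; ring
  have hvt : u * v / (u + v) * n = v * (n - t) := by rw [ht]; field_simp; ring
  set k := ⌊t⌋₊
  have hk : (k : ℝ) ≤ t := Nat.floor_le ht0
  have hk' : t < k + 1 := Nat.lt_floor_add_one t
  have hkn : k ≤ n := by exact_mod_cast hk.trans htn
  obtain ⟨s, hs, hsn, hsv⟩ := h₁ k
  obtain ⟨s', hs', hsn', hsv'⟩ := h₂ (n - k)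
  rw [Nat.cast_sub hkn] at hsv'
  have hdisj : Disjoint s s' := Finset.disjoint_left.2 fun x hx hx' =>
    hEF x (hs hx) x (hs' hx') (by simp)
  refine ⟨s.disjUnion s' hdisj, ?_, by rw [Finset.card_disjUnion, hsn, hsn']; omega, ?_⟩
  · rw [Finset.coe_disjUnion]
    exact Set.union_subset_union hs hs'
  · have e1 : ε * k ≤ ε * n := by gcongr
    have e2 : ε * (n - k) ≤ ε * n := by gcongr; simp
    have e3 : u * k ≤ u * t := by gcongr
    have e4 : v * (n - k) ≤ v * (n - t + 1) := by gcongr; linarith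
    intro a ha
    rw [Finset.sum_disjUnion]
    rcases Finset.mem_disjUnion.1 ha with ha | ha
    · have hz : ∑ b ∈ s', padicValInt p (a - b) = 0 := Finset.sum_eq_zero fun b hb =>
        padicValInt.eq_zero_of_not_dvd (hEF a (hs ha) b (hs' hb))
      rw [hz, add_zero]
      have := hsv a ha
      have := le_max_left C₁ (C₂ + v)
      linarith
    · have hz : ∑ b ∈ s, padicValInt p (a - b) = 0 := Finset.sum_eq_zero fun b hb =>
        padicValInt.eq_zero_of_not_dvd fun hd =>
          hEF b (hs hb) a (hs' ha) (by rwa [dvd_sub_comm])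
      rw [hz, zero_add]
      have := hsv' a ha
      have := le_max_right C₁ (C₂ + v)
      linarith

theorem sum_range_padicValNat_succ (p n : ℕ) [Fact p.Prime] :
    ∑ i ∈ Finset.range n, padicValNat p (i + 1) = padicValNat p n.factorial := by
  induction n with
  | zero => simp
  | succ n ih =>
    rw [Finset.sum_range_succ, ih, Nat.factorial_succ,
      padicValNat.mul (by omega) (Nat.factorial_ne_zero n), add_comm]

theorem padicValNat_two_factorial_le (n : ℕ) : padicValNat 2 n.factorial ≤ n := by
  have := sub_one_mul_padicValNat_factorial (p := 2) n
  omega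

/-- At the node `a` among `0, …, n - 1` the differences multiply to `± a! (n - 1 - a)!`, and `2^m`
bounds the 2-part of `m!`. -/
theorem capacityLE_two_univ : CapacityLE 2 Set.univ 1 := by
  intro ε hε
  refine ⟨0, fun n => ⟨(Finset.range n).map Nat.castEmbedding, by simp, by simp, ?_⟩⟩
  intro a' ha'
  obtain ⟨a, ha, rfl⟩ := Finset.mem_map.1 ha'
  rw [Finset.mem_range] at ha
  obtain ⟨m, rfl⟩ := Nat.exists_eq_add_of_lt ha
  have h1 : ∑ b ∈ Finset.range a, padicValInt 2 ((a : ℤ) - b) =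
      padicValNat 2 a.factorial := by
    rw [← Finset.sum_range_reflect, ← sum_range_padicValNat_succ]
    refine Finset.sum_congr rfl fun i hi => ?_
    rw [Finset.mem_range] at hi
    rw [← padicValInt.of_nat]
    congr 1
    omega
  have h2 : ∑ b ∈ Finset.range (m + 1), padicValInt 2 ((a : ℤ) - (a + b : ℕ)) =
      padicValNat 2 m.factorial := by
    rw [Finset.sum_range_succ', ← sum_range_padicValNat_succ]
    simp only [Nat.cast_add, add_zero, sub_self, padicValInt.zero]
    refine Finset.sum_congr rfl fun i hi => ?_
    rw [padicValInt]
    congr 1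
    omega
  have h3 : ∑ b ∈ (Finset.range (a + m + 1)).map Nat.castEmbedding,
      padicValInt 2 (Nat.castEmbedding a - b : ℤ) ≤ a + m + 1 := by
    rw [Finset.sum_map, add_assoc, Finset.sum_range_add]
    simp only [Nat.castEmbedding_apply]
    rw [h1, h2]
    have := padicValNat_two_factorial_le a
    have := padicValNat_two_factorial_le m
    omega
  have h4 : ((∑ b ∈ (Finset.range (a + m + 1)).map Nat.castEmbedding,
      padicValInt 2 (Nat.castEmbedding a - b : ℤ) : ℕ) : ℝ) ≤ ((a + m + 1 : ℕ) : ℝ) :=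
    Nat.cast_le.2 h3
  have h5 : 0 ≤ ε * ((a + m + 1 : ℕ) : ℝ) := by positivity
  linarith

/-! ### The characteristic sequence -/

/-- Lagrange interpolation for `f` padded by a power of `X` to degree at most `n`, read off at
`X^n`. -/
theorem leadingCoeff_eq_sum_of_natDegree_le {f : ℚ[X]} {n : ℕ} (hf : f.natDegree ≤ n)
    {s : Finset ℤ} (hs : s.card = n + 1) :
    f.leadingCoeff = ∑ a ∈ s, (f.eval (a : ℚ) * (a : ℚ) ^ (n - f.natDegree)) /
      ((∏ b ∈ s.erase a, (a - b) : ℤ) : ℚ) := by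
  have hdeg : (f * X ^ (n - f.natDegree)).natDegree < s.card := by
    refine (natDegree_mul_le.trans ?_).trans_lt (Nat.lt_succ_self n |>.trans_eq hs.symm)
    rw [natDegree_X_pow]
    omega
  have hc := coeff_mul_X_pow f (n - f.natDegree) f.natDegree
  rw [Nat.add_sub_cancel' hf] at hc
  have h := Lagrange.coeff_eq_sum (s := s) (v := fun a : ℤ => (a : ℚ))
    Int.cast_injective.injOn (P := f * X ^ (n - f.natDegree))
    (degree_le_natDegree.trans_lt (by exact_mod_cast hdeg))
  rw [hs, Nat.add_sub_cancel, hc] at h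
  rw [leadingCoeff, h]
  refine Finset.sum_congr rfl fun a _ => ?_
  push_cast
  simp

theorem isFractional_charIdeal {E : Set ℤ} (hE : E.Infinite) (n : ℕ) :
    IsFractional (nonZeroDivisors ℤ) (charIdeal E n) := by
  obtain ⟨s, hsE, hs⟩ := hE.exists_subset_card_eq (n + 1)
  have hne : ∀ a ∈ s, ∏ b ∈ s.erase a, (a - b) ≠ 0 := fun a _ =>
    Finset.prod_ne_zero_iff.2 fun b hb => sub_ne_zero.2 (Finset.ne_of_mem_erase hb).symm
  refine ⟨∏ a ∈ s, ∏ b ∈ s.erase a, (a - b),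
    mem_nonZeroDivisors_of_ne_zero (Finset.prod_ne_zero_iff.2 hne), ?_⟩
  rintro _ ⟨f, hf, hfn, rfl⟩
  rw [leadingCoeff_eq_sum_of_natDegree_le hfn hs, Finset.smul_sum]
  refine sum_mem (S := (algebraMap ℤ ℚ).rangeS) fun a ha => ?_
  obtain ⟨m, hm⟩ := hf a (hsE ha)
  obtain ⟨t, ht⟩ := Finset.dvd_prod_of_mem (fun a => ∏ b ∈ s.erase a, (a - b)) ha
  have hq : ((∏ b ∈ s.erase a, (a - b) : ℤ) : ℚ) ≠ 0 := Int.cast_ne_zero.2 (hne a ha)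
  refine ⟨t * (m * a ^ (n - f.natDegree)), ?_⟩
  rw [ht, hm, zsmul_eq_mul, Int.cast_mul, algebraMap_int_eq, eq_intCast]
  push_cast at hq ⊢
  field_simp

/-- By `p`-adic continuity: with `N f = g` integral, `x ∈ E` close to `y` makes `(g(y) - g(x)) / N`
`p`-integral. This allows interpolation nodes in the closure. -/
theorem padicNorm_eval_le_one {p : ℕ} [Fact p.Prime] {E : Set ℤ} {f : ℚ[X]}
    (hf : f ∈ intValuedPoly E) {y : ℤ} (hy : y ∈ padicClosure p E) :
    padicNorm p (f.eval (y : ℚ)) ≤ 1 := by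
  obtain ⟨N, hN, hg⟩ := IsLocalization.integerNormalization_spec (nonZeroDivisors ℤ) f
  set g := IsLocalization.integerNormalization (nonZeroDivisors ℤ) f
  have hN0 : N ≠ 0 := nonZeroDivisors.ne_zero hN
  have hNq : (N : ℚ) ≠ 0 := by exact_mod_cast hN0
  have hev : ∀ x : ℤ, (N : ℚ) * f.eval (x : ℚ) = (g.eval x : ℤ) := fun x => by
    have := congrArg (eval (x : ℚ)) hg
    rw [eval_smul, zsmul_eq_mul] at this
    rw [← this, algebraMap_int_eq, eval_intCast_map, eq_intCast, Int.cast_id]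
  obtain ⟨x, hx, hxy⟩ := hy (padicValInt p N)
  obtain ⟨m, hm⟩ := hf x hx
  have hd : (p : ℤ) ^ padicValInt p N ∣ g.eval y - g.eval x :=
    hxy.trans (sub_dvd_eval_sub y x g)
  have hNn : padicNorm p N = (p : ℚ) ^ (-(padicValInt p N : ℤ)) := by
    rw [padicNorm.eq_zpow_of_nonzero hNq, padicValRat.of_int]
  have hle : padicNorm p (((g.eval y - g.eval x : ℤ) : ℚ) / N) ≤ 1 := by
    rw [padicNorm.div, div_le_one (lt_of_le_of_ne (padicNorm.nonneg _)
      (padicNorm.nonzero hNq).symm), hNn]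
    refine padicNorm.dvd_iff_norm_le.1 ?_
    exact_mod_cast hd
  have hfy : f.eval (y : ℚ) = m + ((g.eval y - g.eval x : ℤ) : ℚ) / N := by
    rw [Int.cast_sub, ← hev, ← hev, ← hm]
    field_simp
    ring
  rw [hfy]
  exact padicNorm.nonarchimedean.trans (max_le (padicNorm.of_int m) hle)

theorem padicValInt_prod {p : ℕ} [Fact p.Prime] {s : Finset ℤ} {F : ℤ → ℤ}
    (h : ∀ b ∈ s, F b ≠ 0) : padicValInt p (∏ b ∈ s, F b) = ∑ b ∈ s, padicValInt p (F b) := by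
  induction s using Finset.induction_on with
  | empty => simp
  | insert a s ha ih =>
    rw [Finset.prod_insert ha, Finset.sum_insert ha, padicValInt.mul (h a (by simp))
      (Finset.prod_ne_zero_iff.2 fun b hb => h b (by simp [hb])),
      ih fun b hb => h b (by simp [hb])]

theorem neg_le_padicValRat_of_mem_charIdeal {p : ℕ} [Fact p.Prime] {E : Set ℤ} {n K : ℕ}
    {s : Finset ℤ} (hsE : ↑s ⊆ padicClosure p E) (hs : s.card = n + 1)
    (hK : ∀ a ∈ s, ∑ b ∈ s, padicValInt p (a - b) ≤ K) {c : ℚ} (hc : c ∈ charIdeal E n)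
    (hc0 : c ≠ 0) : -(K : ℤ) ≤ padicValRat p c := by
  have hp1 : (1 : ℚ) < p := by exact_mod_cast (Fact.out : p.Prime).one_lt
  obtain ⟨f, hf, hfn, rfl⟩ := hc
  have key : padicNorm p f.leadingCoeff ≤ (p : ℚ) ^ (K : ℤ) := by
    rw [leadingCoeff_eq_sum_of_natDegree_le hfn hs]
    refine padicNorm.sum_le' (fun a ha => ?_) (by positivity)
    have hsub : ∀ b ∈ s.erase a, a - b ≠ 0 := fun b hb =>
      sub_ne_zero.2 (Finset.ne_of_mem_erase hb).symm
    have hne : ∏ b ∈ s.erase a, (a - b) ≠ 0 := Finset.prod_ne_zero_iff.2 hsub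
    have hv : padicValInt p (∏ b ∈ s.erase a, (a - b)) ≤ K := by
      rw [padicValInt_prod hsub]
      exact (Finset.sum_le_sum_of_subset (Finset.erase_subset a s)).trans (hK a ha)
    have hnum : padicNorm p (f.eval (a : ℚ) * (a : ℚ) ^ (n - f.natDegree)) ≤ 1 := by
      rw [padicNorm.mul]
      refine mul_le_one₀ (padicNorm_eval_le_one hf (hsE ha)) (padicNorm.nonneg _) ?_
      exact_mod_cast padicNorm.of_int (a ^ (n - f.natDegree))
    have hq : ((∏ b ∈ s.erase a, (a - b) : ℤ) : ℚ) ≠ 0 := Int.cast_ne_zero.2 hne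
    rw [padicNorm.div, padicNorm.eq_zpow_of_nonzero hq, padicValRat.of_int, zpow_neg,
      div_inv_eq_mul]
    refine (mul_le_of_le_one_left (by positivity) hnum).trans ?_
    exact zpow_le_zpow_right₀ hp1.le (by exact_mod_cast hv)
  rw [padicNorm.eq_zpow_of_nonzero hc0] at key
  have := (zpow_le_zpow_iff_right₀ hp1).1 key
  linarith

theorem exists_mem_charIdeal {p : ℕ} [Fact p.Prime] {E : Set ℤ} {f : ℤ[X]} (hf : f.Monic)
    {e : ℕ} (he : ∀ x ∈ E, (p : ℤ) ^ e ∣ f.eval x) :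
    ∃ c ∈ charIdeal E f.natDegree, c ≠ 0 ∧ padicValRat p c = -(e : ℤ) := by
  have hp0 : (p : ℚ) ≠ 0 := by exact_mod_cast (Fact.out : p.Prime).ne_zero
  have hpe : ((p : ℚ) ^ e)⁻¹ ≠ 0 := inv_ne_zero (pow_ne_zero e hp0)
  refine ⟨((p : ℚ) ^ e)⁻¹, ⟨C (((p : ℚ) ^ e)⁻¹) * f.map (Int.castRingHom ℚ), ?_, ?_, ?_⟩,
    hpe, ?_⟩
  · intro x hx
    obtain ⟨m, hm⟩ := he x hx
    refine ⟨m, ?_⟩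
    have : (f.map (Int.castRingHom ℚ)).eval (x : ℚ) = ((f.eval x : ℤ) : ℚ) := by
      simp
    rw [eval_mul, eval_C, this, hm]
    push_cast
    field_simp
  · rw [natDegree_C_mul hpe]
    exact natDegree_map_le
  · rw [leadingCoeff_mul, leadingCoeff_C, (hf.map _).leadingCoeff, mul_one]
  · rw [padicValRat.inv, padicValRat.pow, padicValRat.self (Fact.out : p.Prime).one_lt,
      mul_one]

theorem hasValuativeCapacity_of_capacityGE_of_capacityLE {p : ℕ} [Fact p.Prime] {E : Set ℤ}
    {L : ℝ} (hE : E.Infinite) (hl : CapacityGE p E L) (hu : CapacityLE p (padicClosure p E) L) :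
    HasValuativeCapacity E p L := by
  refine ⟨isFractional_charIdeal hE, ?_⟩
  rw [Metric.tendsto_atTop]
  intro ε hε
  obtain ⟨C₁, h₁⟩ := hl (ε / 2) (by linarith)
  obtain ⟨C₂, h₂⟩ := hu (ε / 2) (by linarith)
  -- Interpolation in degree `n` takes `n + 1` nodes, hence the extra `L + ε / 2`.
  set C := max C₁ (C₂ + (L + ε / 2)) with hC
  obtain ⟨N, hN⟩ := exists_nat_gt (max 0 (C / (ε / 2)))
  refine ⟨N, fun n hn => ?_⟩
  have hNn : (N : ℝ) ≤ n := by exact_mod_cast hn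
  have hn0 : (0 : ℝ) < n := (le_max_left _ _).trans_lt (hN.trans_le hNn)
  have hCn : C < ε / 2 * n := by
    rw [← div_lt_iff₀' (by linarith)]
    exact (le_max_right _ _).trans_lt (hN.trans_le hNn)
  obtain ⟨f, hf, hfn, e, he, hfE⟩ := h₁ n
  obtain ⟨s, hsE, hs, hsK⟩ := h₂ (n + 1)
  obtain ⟨c, hcI, hc0, hcv⟩ := exists_mem_charIdeal hf hfE
  rw [hfn] at hcI
  have hsne : s.Nonempty := Finset.card_pos.1 (by omega)
  obtain ⟨a, ha, hmax⟩ := s.exists_max_image (fun a => ∑ b ∈ s, padicValInt p (a - b)) hsne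
  set K := ∑ b ∈ s, padicValInt p (a - b)
  have hlow : ∀ v ∈ {v : ℤ | ∃ c ∈ charIdeal E n, c ≠ 0 ∧ padicValRat p c = v},
      -(K : ℤ) ≤ v := by
    rintro _ ⟨c, hc, hc0, rfl⟩
    exact neg_le_padicValRat_of_mem_charIdeal hsE hs hmax hc hc0
  -- The infimum in `ℤ` is meaningful only for a nonempty set bounded below: the polynomial supplies
  -- an element, the nodes a bound.
  have hle : charSeq E p n ≤ K := neg_le.1 (le_csInf ⟨_, c, hcI, hc0, rfl⟩ hlow)
  have hge : (e : ℤ) ≤ charSeq E p n :=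
    le_neg.1 (csInf_le ⟨_, hlow⟩ ⟨c, hcI, hc0, hcv⟩)
  have hle' : (charSeq E p n : ℝ) ≤ K := by exact_mod_cast hle
  have hge' : (e : ℝ) ≤ charSeq E p n := by exact_mod_cast hge
  have hKb := hsK a ha
  push_cast at hKb
  have hKb' : (K : ℝ) ≤ (L + ε / 2) * (n + 1) + C₂ := by simpa [K] using hKb
  have m1 : C₁ ≤ C := le_max_left _ _
  have m2 : C₂ + (L + ε / 2) ≤ C := le_max_right _ _
  rw [Real.dist_eq, abs_sub_lt_iff, sub_lt_iff_lt_add, div_lt_iff₀ hn0, sub_lt_comm,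
    lt_div_iff₀ hn0]
  constructor <;> linarith

/-! ### Powers and their `2`-adic limits -/

theorem two_pow_dvd_sq_sub_one {k : ℕ} (hk : 1 ≤ k) {x : ℤ} (hx : 2 ^ k ∣ x - 1) :
    2 ^ (k + 1) ∣ x ^ 2 - 1 := by
  have h2 : (2 : ℤ) ∣ x + 1 := by
    have := (dvd_pow_self (2 : ℤ) (by omega : k ≠ 0)).trans hx
    omega
  rw [pow_succ, show x ^ 2 - 1 = (x - 1) * (x + 1) by ring]
  exact mul_dvd_mul hx h2

/-- Odd squares are `1` mod 8, and each further squaring gains a factor 2. -/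
theorem two_pow_dvd_pow_sub_one {x : ℤ} (hx : Odd x) (α β : ℕ) (hα : 1 ≤ α) :
    2 ^ (α + 2) ∣ x ^ (2 ^ α * β) - 1 := by
  have h : (2 : ℤ) ^ (α + 2) ∣ x ^ 2 ^ α - 1 := by
    induction α, hα using Nat.le_induction with
    | base => simpa using Int.eight_dvd_sq_sub_one_of_odd hx
    | succ n hn ih =>
      rw [pow_succ 2 n, pow_mul]
      exact two_pow_dvd_sq_sub_one (by omega) ih
  rw [pow_mul]
  refine h.trans ?_
  simpa using sub_dvd_pow_sub_pow (x ^ 2 ^ α) 1 β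

theorem exists_two_pow_dvd_sub_sq {k : ℕ} (hk : 2 ≤ k) {y : ℤ} (hy : 2 ^ (k + 1) ∣ y - 1)
    (N : ℕ) : ∃ z : ℤ, 2 ^ k ∣ z - 1 ∧ 2 ^ N ∣ y - z ^ 2 := by
  rcases le_total N (k + 1) with hN | hN
  · exact ⟨1, by simp, by simpa using (pow_dvd_pow 2 hN).trans hy⟩
  induction N, hN using Nat.le_induction with
  | base => exact ⟨1, by simp, by simpa using hy⟩
  | succ N hN ih =>
    obtain ⟨z, hz, c, hc⟩ := ih
    have hzo : (2 : ℤ) ∣ z - 1 := (dvd_pow_self (2 : ℤ) (by omega : k ≠ 0)).trans hz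
    obtain ⟨t, ht⟩ := hzo
    obtain ⟨M, rfl⟩ : ∃ M, N = M + 3 := ⟨N - 3, by omega⟩
    -- Hensel correction: the square changes by `2^(M+3) z c` mod `2^(M+4)`, and `z` is odd, so the
    -- error `2^(M+3) c` is cancelled.
    refine ⟨z + 2 ^ (M + 2) * c, ?_, ?_⟩
    · rw [add_sub_right_comm]
      exact dvd_add hz ((pow_dvd_pow 2 (by omega)).mul_right c)
    · refine ⟨-(t * c) - 2 ^ M * c ^ 2, ?_⟩
      have : y = z ^ 2 + 2 ^ (M + 3) * c := by linarith
      rw [this, show z = 2 * t + 1 by linarith]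
      ring

theorem exists_two_pow_dvd_sub_pow_two_pow (N α : ℕ) {y : ℤ} (hy : 2 ^ (α + 2) ∣ y - 1) :
    ∃ z : ℤ, 2 ^ 2 ∣ z - 1 ∧ 2 ^ N ∣ y - z ^ 2 ^ α := by
  induction α generalizing y with
  | zero => exact ⟨y, hy, by simp⟩
  | succ α ih =>
    obtain ⟨w, hw, hwN⟩ := exists_two_pow_dvd_sub_sq (by omega : 2 ≤ α + 2) hy N
    obtain ⟨z, hz, hzN⟩ := ih hw
    refine ⟨z, hz, ?_⟩
    rw [pow_succ 2 α, pow_mul, ← sub_add_sub_cancel y (w ^ 2)]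
    exact dvd_add hwN (hzN.trans (sub_dvd_pow_sub_pow _ _ 2))

/-- The units mod `2^N` form a group of 2-power order, on which an odd power map is bijective. -/
theorem exists_two_pow_dvd_sub_odd_pow (N : ℕ) {β : ℕ} (hβ : Odd β) {z : ℤ} (hz : Odd z) :
    ∃ w : ℤ, 2 ^ N ∣ z - w ^ β := by
  have : NeZero (2 ^ N) := ⟨by positivity⟩
  have hcop : (Nat.card (ZMod (2 ^ N))ˣ).Coprime β := by
    rw [Nat.card_eq_fintype_card, ZMod.card_units_eq_totient]
    rcases N with _ | N
    · simp
    · rw [Nat.totient_prime_pow_succ Nat.prime_two]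
      simpa using (Nat.coprime_two_left.2 hβ).pow_left N
  have hu : IsUnit ((z : ℤ) : ZMod (2 ^ N)) := by
    rw [ZMod.coe_int_isUnit_iff_isCoprime]
    push_cast
    exact (Int.isCoprime_two_left.2 hz).pow_left
  obtain ⟨u, hu⟩ := hu
  obtain ⟨w, hw⟩ := (powCoprime hcop).surjective u
  refine ⟨((w : ZMod (2 ^ N)).val : ℤ), ?_⟩
  have h := (ZMod.intCast_zmod_eq_zero_iff_dvd (z - ((w : ZMod (2 ^ N)).val : ℤ) ^ β) (2 ^ N))
  have h2 : (2 ^ N : ℤ) = ((2 ^ N : ℕ) : ℤ) := by push_cast; rfl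
  rw [h2, ← h]
  push_cast
  rw [ZMod.natCast_zmod_val, ← hu, ← hw]
  simp [powCoprime]

theorem exists_two_pow_dvd_sub_pow (N : ℕ) {α β : ℕ} (hβ : Odd β) {y : ℤ}
    (hy : 2 ^ (α + 2) ∣ y - 1) : ∃ w : ℤ, 2 ^ N ∣ y - w ^ (2 ^ α * β) := by
  obtain ⟨z, hz, hzN⟩ := exists_two_pow_dvd_sub_pow_two_pow N α hy
  have hzo : Odd z := by
    rw [Int.odd_iff]
    omega
  obtain ⟨w, hw⟩ := exists_two_pow_dvd_sub_odd_pow N hβ hzo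
  refine ⟨w, ?_⟩
  rw [mul_comm, pow_mul, ← sub_add_sub_cancel y (z ^ 2 ^ α)]
  exact dvd_add hzN (hw.trans (sub_dvd_pow_sub_pow _ _ _))

/-! ### Sums of two `d`-th powers -/

theorem infinite_dthPowers_add_dthPowers {d : ℕ} (hd : d ≠ 0) :
    (dthPowers d + dthPowers d).Infinite := by
  refine Set.infinite_of_injective_forall_mem (f := fun n : ℕ => (n : ℤ) ^ d) ?_ ?_
  · intro a b hab
    have h : a ^ d = b ^ d := by
      simp only at hab
      exact_mod_cast hab
    exact Nat.pow_left_injective hd h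
  · exact fun n => ⟨_, ⟨n, rfl⟩, _, ⟨0, rfl⟩, by simp [hd]⟩

/-- The image of `E` under the self-similarity of the closure of the set of sums of two `d`-th
powers, `d = 2 ^ α * β`. -/
def powerSumStep (α d : ℕ) (E : Set ℤ) : Set ℤ :=
  (fun x => 1 + ((2 : ℕ) : ℤ) ^ (α + 2) * x) '' Set.univ ∪
    (fun x => 0 + ((2 : ℕ) : ℤ) ^ 1 * x) ''
      ((fun x => 1 + ((2 : ℕ) : ℤ) ^ (α + 1) * x) '' Set.univ ∪
        (fun x => 0 + ((2 : ℕ) : ℤ) ^ (d - 1) * x) '' E)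

/-- Makes even `d`-th powers vanish mod `2^(α+2)`, so that odd plus even stays in `1 + 2^(α+2)ℤ`;
false for `d = 2`. -/
theorem add_two_le_two_pow_mul {α β : ℕ} (hα : 1 ≤ α) (hβ : Odd β) (hd : 2 < 2 ^ α * β) :
    α + 2 ≤ 2 ^ α * β := by
  rcases hα.eq_or_lt with rfl | hα
  · obtain ⟨k, rfl⟩ := hβ
    omega
  · have h : α + 2 ≤ 2 ^ α := by
      induction α, hα using Nat.le_induction with
      | base => norm_num
      | succ n hn ih =>
        have := ih (by omega) ((show 2 < 2 ^ n by
          calc 2 < 2 ^ 2 := by norm_num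
            _ ≤ 2 ^ n := Nat.pow_le_pow_right (by norm_num) hn).trans_le
              (Nat.le_mul_of_pos_right _ hβ.pos))
        rw [pow_succ]
        omega
    exact h.trans (Nat.le_mul_of_pos_right _ hβ.pos)

theorem dthPowers_add_dthPowers_subset {α β d : ℕ} (hα : 1 ≤ α) (hβ : Odd β)
    (hd : d = 2 ^ α * β) (hd2 : 2 < d) :
    dthPowers d + dthPowers d ⊆ powerSumStep α d (dthPowers d + dthPowers d) := by
  have hle : α + 2 ≤ d := hd ▸ add_two_le_two_pow_mul hα hβ (hd ▸ hd2)
  have hodd : ∀ x : ℤ, Odd x → ∃ t, x ^ d = 1 + 2 ^ (α + 2) * t := fun x hx => by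
    obtain ⟨t, ht⟩ := two_pow_dvd_pow_sub_one hx α β hα
    exact ⟨t, by rw [hd]; linarith⟩
  have heven : ∀ x : ℤ, Even x → ∃ y, x ^ d = 2 ^ d * y ^ d := fun x hx => by
    obtain ⟨y, rfl⟩ := hx.two_dvd
    exact ⟨y, mul_pow _ _ _⟩
  have hpow : ∀ t : ℤ, 2 ^ d * t = 2 ^ (α + 2) * (2 ^ (d - (α + 2)) * t) := fun t => by
    rw [← mul_assoc, ← pow_add, Nat.add_sub_cancel' hle]
  rintro _ ⟨_, ⟨x, rfl⟩, _, ⟨y, rfl⟩, rfl⟩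
  simp only
  rcases Int.even_or_odd x with hx | hx <;> rcases Int.even_or_odd y with hy | hy
  · obtain ⟨s, hs⟩ := heven x hx
    obtain ⟨t, ht⟩ := heven y hy
    refine Or.inr ⟨2 ^ (d - 1) * (s ^ d + t ^ d), Or.inr ⟨s ^ d + t ^ d,
      ⟨_, ⟨s, rfl⟩, _, ⟨t, rfl⟩, rfl⟩, by simp⟩, ?_⟩
    obtain ⟨k, rfl⟩ : ∃ k, d = k + 1 := ⟨d - 1, by omega⟩
    simp only [hs, ht, Nat.add_sub_cancel, Nat.cast_ofNat]
    ring
  · obtain ⟨s, hs⟩ := heven x hx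
    obtain ⟨t, ht⟩ := hodd y hy
    refine Or.inl ⟨2 ^ (d - (α + 2)) * s ^ d + t, trivial, ?_⟩
    simp only [hs, ht, hpow, Nat.cast_ofNat]
    ring
  · obtain ⟨s, hs⟩ := hodd x hx
    obtain ⟨t, ht⟩ := heven y hy
    refine Or.inl ⟨s + 2 ^ (d - (α + 2)) * t ^ d, trivial, ?_⟩
    simp only [hs, ht, hpow, Nat.cast_ofNat]
    ring
  · obtain ⟨s, hs⟩ := hodd x hx
    obtain ⟨t, ht⟩ := hodd y hy
    refine Or.inr ⟨1 + 2 ^ (α + 1) * (s + t), Or.inl ⟨s + t, trivial, by simp⟩, ?_⟩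
    simp only [hs, ht, Nat.cast_ofNat]
    ring

/-- The three pieces are approximated by `w^d + 0^d`, `w^d + 1^d` and `(2x)^d + (2y)^d`. -/
theorem powerSumStep_padicClosure_subset {α β d : ℕ} (hβ : Odd β) (hd : d = 2 ^ α * β) :
    powerSumStep α d (padicClosure 2 (dthPowers d + dthPowers d)) ⊆
      padicClosure 2 (dthPowers d + dthPowers d) := by
  have hd0 : d ≠ 0 := by
    rw [hd]
    exact mul_ne_zero (by positivity) hβ.pos.ne'
  have happrox : ∀ (N : ℕ) (t : ℤ), ∃ w : ℤ, 2 ^ N ∣ 1 + 2 ^ (α + 2) * t - w ^ d :=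
    fun N t => hd ▸ exists_two_pow_dvd_sub_pow N hβ (by simp)
  rintro _ (⟨t, -, rfl⟩ | ⟨_, ⟨t, -, rfl⟩ | ⟨t, ht, rfl⟩, rfl⟩) <;> intro N <;>
    simp only [Nat.cast_ofNat]
  · obtain ⟨w, hw⟩ := happrox N t
    exact ⟨w ^ d + 0 ^ d, ⟨_, ⟨w, rfl⟩, _, ⟨0, rfl⟩, rfl⟩, by simpa [hd0] using hw⟩
  · obtain ⟨w, hw⟩ := happrox N t
    refine ⟨w ^ d + 1 ^ d, ⟨_, ⟨w, rfl⟩, _, ⟨1, rfl⟩, rfl⟩, ?_⟩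
    convert hw using 1
    ring
  · obtain ⟨_, ⟨_, ⟨x, rfl⟩, _, ⟨y, rfl⟩, rfl⟩, c, hc⟩ := ht N
    refine ⟨(2 * x) ^ d + (2 * y) ^ d, ⟨_, ⟨_, rfl⟩, _, ⟨_, rfl⟩, rfl⟩, 2 ^ d * c, ?_⟩
    simp only [Nat.cast_ofNat] at hc
    obtain ⟨k, rfl⟩ : ∃ k, d = k + 1 := ⟨d - 1, by omega⟩
    rw [Nat.add_sub_cancel, mul_pow, mul_pow, eq_add_of_sub_eq hc]
    ring

/-- The capacity of `powerSumStep α d E` in terms of the capacity `l` of `E`. -/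
noncomputable def powerSumCapacity (α d l : ℝ) : ℝ :=
  (α + 3) * (1 + (α + 2) * (d - 1 + l) / (α + 2 + (d - 1 + l))) /
    (α + 3 + (1 + (α + 2) * (d - 1 + l) / (α + 2 + (d - 1 + l))))

theorem CapacityGE.powerSumStep {α d : ℕ} (hd : 2 < d) {E : Set ℤ} {l : ℝ} (hl : 0 ≤ l)
    (h : CapacityGE 2 E l) : CapacityGE 2 (powerSumStep α d E) (powerSumCapacity α d l) := by
  have hd' : (2 : ℝ) < d := by exact_mod_cast hd
  have hd1 : ((d - 1 : ℕ) : ℝ) + l = d - 1 + l := by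
    rw [Nat.cast_sub (by omega), Nat.cast_one]
  have h1 := capacityGE_two_univ.image_affine 1 (α + 2)
  have h2 := capacityGE_two_univ.image_affine 1 (α + 1)
  have h3 := h.image_affine 0 (d - 1)
  rw [hd1] at h3
  have hpos : 0 < (d : ℝ) - 1 + l := by linarith
  have h4 := (h2.union h3 (by positivity) hpos).image_affine 0 1
  refine (h1.union h4 (by positivity) (by positivity)).mono subset_rfl (le_of_eq ?_)
  rw [powerSumCapacity]
  push_cast
  rw [show (α : ℝ) + 2 + 1 = α + 3 by ring, show (α : ℝ) + 1 + 1 = α + 2 by ring]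

theorem CapacityLE.powerSumStep {α d : ℕ} (hd : 2 < d) {E : Set ℤ} {u : ℝ} (hu : 0 ≤ u)
    (h : CapacityLE 2 E u) : CapacityLE 2 (powerSumStep α d E) (powerSumCapacity α d u) := by
  have hd' : (2 : ℝ) < d := by exact_mod_cast hd
  have hd1 : ((d - 1 : ℕ) : ℝ) + u = d - 1 + u := by
    rw [Nat.cast_sub (by omega), Nat.cast_one]
  have h1 := capacityLE_two_univ.image_affine 1 (α + 2)
  have h2 := capacityLE_two_univ.image_affine 1 (α + 1)
  have h3 := h.image_affine 0 (d - 1)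
  rw [hd1] at h3
  have hpos : 0 < (d : ℝ) - 1 + u := by linarith
  have hpow : ∀ k : ℕ, k ≠ 0 → ∀ x : ℤ, (2 : ℤ) ∣ 2 ^ k * x := fun k hk x =>
    (dvd_pow_self 2 hk).mul_right x
  have h4 := (h2.union h3 (by positivity) hpos (by
    rintro _ ⟨x, -, rfl⟩ _ ⟨y, -, rfl⟩
    have e1 := hpow (α + 1) (by omega) x
    have e2 := hpow (d - 1) (by omega) y
    simp only [Nat.cast_ofNat]
    omega)).image_affine 0 1
  refine (h1.union h4 (by positivity) (by positivity) ?_).mono subset_rfl (le_of_eq ?_)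
  · rintro _ ⟨x, -, rfl⟩ _ ⟨y, -, rfl⟩
    have e1 := hpow (α + 2) (by omega) x
    simp only [Nat.cast_ofNat]
    omega
  · rw [powerSumCapacity]
    push_cast
    rw [show (α : ℝ) + 2 + 1 = α + 3 by ring, show (α : ℝ) + 1 + 1 = α + 2 by ring]

/-! ### The fixed-point equation and its positive root -/

theorem powerSumCapacity_sub_self {α d l : ℝ} (hα : 0 ≤ α) (hd : 2 < d) (hl : 0 ≤ l) :
    powerSumCapacity α d l - l = -((2 * α + 6) * l ^ 2 + (2 * α * d - 2 * α + 6 * d - 7) * l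
      + (α + 3 - α ^ 2 * d - 6 * α * d - 9 * d)) /
        ((α + 3) * (α + 2 + (d - 1 + l)) + ((α + 2 + (d - 1 + l)) + (α + 2) * (d - 1 + l))) := by
  have h1 : 0 < d - 1 + l := by linarith
  have h2 : α + 2 + (d - 1 + l) ≠ 0 := by positivity
  have h3 : (α + 3) * (α + 2 + (d - 1 + l)) +
      ((α + 2 + (d - 1 + l)) + (α + 2) * (d - 1 + l)) ≠ 0 := by
    positivity
  have h4 : α + 3 + (1 + (α + 2) * (d - 1 + l) / (α + 2 + (d - 1 + l))) =
      ((α + 3) * (α + 2 + (d - 1 + l)) + ((α + 2 + (d - 1 + l)) + (α + 2) * (d - 1 + l))) /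
        (α + 2 + (d - 1 + l)) := by
    field_simp
  rw [powerSumCapacity, h4, eq_div_iff h3, sub_mul]
  generalize hD : (α + 3) * (α + 2 + (d - 1 + l)) +
    ((α + 2 + (d - 1 + l)) + (α + 2) * (d - 1 + l)) = D at *
  field_simp
  rw [← hD]
  ring

/-- For `a > 0 > c` and `x > 0` the last factor is negative at every `y ≥ 0`, so the sign of the
quadratic there is that of `y - x`. This drives both iterations and uniqueness. -/
theorem quadratic_eval_mul_root {a b c x y : ℝ} (hx : a * x ^ 2 + b * x + c = 0) :
    x * (a * y ^ 2 + b * y + c) = (x - y) * (c - a * x * y) := by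
  linear_combination y * hx

theorem exists_pos_quadratic_root {a b c : ℝ} (ha : 0 < a) (hc : c < 0) :
    ∃ x, 0 < x ∧ a * x ^ 2 + b * x + c = 0 := by
  have h : 0 < -(4 * a * c) := by nlinarith
  have hs : √(b ^ 2 - 4 * a * c) ^ 2 = b ^ 2 - 4 * a * c := Real.sq_sqrt (by nlinarith [sq_nonneg b])
  refine ⟨(-b + √(b ^ 2 - 4 * a * c)) / (2 * a), ?_, ?_⟩
  · have : |b| < √(b ^ 2 - 4 * a * c) := Real.lt_sqrt_of_sq_lt (by rw [sq_abs]; linarith)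
    have := le_abs_self b
    exact div_pos (by linarith) (by linarith)
  · generalize √(b ^ 2 - 4 * a * c) = r at hs
    field_simp
    linear_combination hs

theorem mainTheorem11 (α β d : ℕ) (hα : 1 ≤ α) (hβ : Odd β) (hd : d = 2 ^ α * β)
    (hd2 : 2 < d) :
    ∃ L : ℝ, HasValuativeCapacity (dthPowers d + dthPowers d) 2 L ∧
      0 < L ∧
      (2 * (α : ℝ) + 6) * L ^ 2 + (2 * α * d - 2 * α + 6 * d - 7) * L
        + (α + 3 - α ^ 2 * d - 6 * α * d - 9 * d) = 0 ∧
      ∀ x : ℝ, 0 < x →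
        (2 * (α : ℝ) + 6) * x ^ 2 + (2 * α * d - 2 * α + 6 * d - 7) * x
          + (α + 3 - α ^ 2 * d - 6 * α * d - 9 * d) = 0 →
        x = L := by
  have hα0 : (0 : ℝ) ≤ α := α.cast_nonneg
  have hdR : (2 : ℝ) < d := by exact_mod_cast hd2
  have ha : 0 < 2 * (α : ℝ) + 6 := by positivity
  have hc : (α + 3 - α ^ 2 * d - 6 * α * d - 9 * d : ℝ) < 0 := by
    have h1 : (0 : ℝ) ≤ α ^ 2 * d := by positivity
    have h2 : (α : ℝ) * 2 ≤ α * d := by gcongr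
    linarith
  have hquad := fun l : ℝ => powerSumCapacity_sub_self (l := l) hα0 hdR
  have hden : ∀ l : ℝ, 0 ≤ l → 0 < (α + 3) * (α + 2 + (d - 1 + l)) +
      ((α + 2 + (d - 1 + l)) + (α + 2) * (d - 1 + l)) := fun l hl => by
    have : 0 < (d : ℝ) - 1 + l := by linarith
    positivity
  obtain ⟨L, hL, hroot⟩ := exists_pos_quadratic_root
    (b := (2 * α * d - 2 * α + 6 * d - 7 : ℝ)) ha hc
  have hmul := fun y => quadratic_eval_mul_root (y := y) hroot
  refine ⟨L, hasValuativeCapacity_of_capacityGE_of_capacityLE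
    (infinite_dthPowers_add_dthPowers (by omega)) ?_ ?_, hL, hroot, fun x hx h => ?_⟩
  · refine CapacityGE.of_iterate hL.le (powerSumCapacity α d) (fun l h0 hl => ?_)
      fun l h0 _ h => (h.powerSumStep hd2 h0).mono
        (dthPowers_add_dthPowers_subset hα hβ hd hd2) le_rfl
    rw [← sub_pos, hquad l h0]
    refine div_pos (neg_pos.2 (neg_of_mul_neg_right ?_ hL.le)) (hden l h0)
    rw [hmul]
    have : 0 ≤ (2 * (α : ℝ) + 6) * L * l := by positivity
    exact mul_neg_of_pos_of_neg (by linarith) (by linarith)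
  -- The iteration needs some finite bound to start: the closure contains `1 + 2^(α+2)ℤ`, which
  -- gives `α + 3`.
  · have hstart : CapacityLE 2 (padicClosure 2 (dthPowers d + dthPowers d))
        (max L ((α + 2 : ℕ) + 1)) :=
      (capacityLE_two_univ.image_affine 1 (α + 2)).mono
        (Set.subset_union_left.trans (powerSumStep_padicClosure_subset hβ hd)) (le_max_right _ _)
    refine CapacityLE.of_iterate (le_max_left _ _) hstart (powerSumCapacity α d)
      (fun u hu => ?_) fun u hu h => (h.powerSumStep hd2 (hL.trans hu).le).mono
        (powerSumStep_padicClosure_subset hβ hd) le_rfl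
    have hu0 : 0 < u := hL.trans hu
    rw [← sub_neg, hquad u hu0.le]
    refine div_neg_of_neg_of_pos (neg_lt_zero.2 (pos_of_mul_pos_right ?_ hL.le)) (hden u hu0.le)
    rw [hmul]
    have : 0 < (2 * (α : ℝ) + 6) * L * u := by positivity
    exact mul_pos_of_neg_of_neg (by linarith) (by linarith)
  · have h1 := hmul x
    rw [h, mul_zero] at h1
    have : 0 < (2 * (α : ℝ) + 6) * L * x := by positivity
    rcases mul_eq_zero.1 h1.symm with h2 | h2 <;> linarith
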